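/- Let $F$ be a field of characteristic different from $2$ and let $q$ be an anisotropic (hence non-degenerate) quadratic form on a finite-dimensional nonzero $F$-vector space. For a field extension $K/F$ write $q_K$ for the form obtained from $q$ by extending scalars to $K$, $D_K(q)=\{a\in K^\times : a=q_K(v)\text{ for some vector }v\}$ and $G_K(q)=\{a\in K^\times : a\,q_K\simeq q_K\}$. Call $q$ a *group form over $K$* if $D_K(q)$ is a subgroup of $K^\times$, and *round over $K$* if it is a group form over $K$ and $D_K(q)=G_K(q)$. Call $q$ a *Pfister form over $F$* if $q\simeq\langle 1,a_1\rangle\otimes\cdots\otimes\langle 1,a_n\rangle$ for some $n\geq 0$ and $a_1,\ldots,a_n\in F^\times$ (for $n=0$ this means $q\simeq\langle 1\rangle$). Then the following are equivalent: (i) $q$ is a Pfister form over $F$; (ii) $q$ is round over $K$ for every field extension $K/F$; (iii) $q$ is a group form over $K$ for every field extension $K/F$. -/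

import Mathlib

open scoped TensorProduct

universe u v w

namespace QuadraticForm

section Basic

variable {F : Type u} [Field F] {V : Type v} [AddCommGroup V] [Module F V]

/-- The value set `D_F(q)`: the nonzero elements of `F` represented by `q`. -/
def valueSet (q : QuadraticForm F V) : Set Fˣ :=
  {a | ∃ x : V, q x = (a : F)}

/-- The set `G_F(q)` of similarity factors: those `a ∈ Fˣ` such that `a q` is isometric to `q`. -/
def similarityFactors (q : QuadraticForm F V) : Set Fˣ :=
  {a | QuadraticMap.Equivalent ((a : F) • q) q}

/-- `q` is a group form over `F` if `D_F(q)` is a subgroup of `Fˣ`. -/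
def IsGroupForm (q : QuadraticForm F V) : Prop :=
  ∃ H : Subgroup Fˣ, (H : Set Fˣ) = valueSet q

/-- `q` is round over `F` if it is a group form and `D_F(q) = G_F(q)`. -/
def IsRound (q : QuadraticForm F V) : Prop :=
  IsGroupForm q ∧ valueSet q = similarityFactors q

end Basic

section Pfister

variable {F : Type u} [Field F] [Invertible (2 : F)]

/-- The form `⟨1, a₁⟩ ⊗ ⋯ ⊗ ⟨1, aₙ⟩`, bundled with its underlying vector space.
The empty product is the one-dimensional form `⟨1⟩`. -/
noncomputable def pfisterForm : List Fˣ → QuadraticModuleCat.{u} F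
  | [] => QuadraticModuleCat.of (QuadraticMap.weightedSumSquares F ![(1 : F)])
  | a :: l => QuadraticModuleCat.of
      (QuadraticForm.tmul (QuadraticMap.weightedSumSquares F ![(1 : F), (a : F)])
        (pfisterForm l).form)

/-- `q` is a Pfister form over `F`: it is isometric to `⟨1, a₁⟩ ⊗ ⋯ ⊗ ⟨1, aₙ⟩` for some `n ≥ 0`
and some `a₁, …, aₙ ∈ Fˣ`. -/
def IsPfister {V : Type v} [AddCommGroup V] [Module F V] (q : QuadraticForm F V) : Prop :=
  ∃ l : List Fˣ, QuadraticMap.Equivalent q (pfisterForm l).form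

end Pfister

end QuadraticForm

set_option autoImplicit false

open QuadraticMap Polynomial Module

/-! A Pfister form arises from `⟨1⟩` by doublings `Q ↦ Q ⊥ aQ`, and doubling preserves the property
that every nonzero value is a similarity factor (`HasSimilarValues.prod_smul`). Since a Pfister form
represents `1`, it is round over every extension.

Conversely, a group form `q` represents `1`, so it contains the Pfister form `⟨1⟩`. If a Pfister
form `w` embeds in `q` with proper image, a vector orthogonal to the image, of value `a`, gives `w ⊥
⟨a⟩ ⊂ q`. Over any `K`, similarity of the values of `w` writes each value of `w ⊥ aw` either as a
value of `w` or as a value of `w` times one of `w ⊥ ⟨a⟩`; as `q` is a group form, it is a value of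
`q`. Pfister's subform theorem (`nonempty_isometry_of_values`) then embeds `w ⊥ aw` in `q`. The
dimension doubles until `w` fills `q`.

The subform theorem splits off one diagonal entry at a time by testing values over `K(t)`; the
Cassels–Pfister theorem (`exists_polynomial_of_ratFunc`) brings the resulting representations back
to `K`. -/

namespace QuadraticForm

/-! ### Diagonal forms over varying algebras -/

section Scalars

variable {F A B ι : Type*} [CommRing F] [CommRing A] [Algebra F A] [CommRing B] [Algebra F B]
  [Fintype ι]

theorem weightedSumSquares_map (w : ι → F) (σ : A →ₐ[F] B) (x : ι → A) :
    weightedSumSquares B w (fun i => σ (x i)) = σ (weightedSumSquares A w x) := by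
  simp [weightedSumSquares_apply]

theorem weightedSumSquares_elim {κ : Type*} [Fintype κ] (w : ι → F) (v : κ → F)
    (x : ι ⊕ κ → A) :
    weightedSumSquares A (Sum.elim w v) x =
      weightedSumSquares A w (x ∘ Sum.inl) + weightedSumSquares A v (x ∘ Sum.inr) := by
  simp [weightedSumSquares_apply, Fintype.sum_sum_type]

theorem weightedSumSquares_cons {n : ℕ} (a : F) (w : Fin n → F) (x : Fin (n + 1) → A) :
    weightedSumSquares A (Fin.cons a w : Fin (n + 1) → F) x =
      a • (x 0 * x 0) + weightedSumSquares A w (Fin.tail x) := by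
  simp [weightedSumSquares_apply, Fin.sum_univ_succ, Fin.tail]

theorem weightedSumSquares_smul (a : F) (w : ι → F) (x : ι → A) :
    weightedSumSquares A (a • w) x = a • weightedSumSquares A w x := by
  simp [weightedSumSquares_apply, Finset.smul_sum, mul_smul]

/-- The second intersection of a quadric `Q = p` with the line through the point `u + g⁻¹ r`
of the quadric and the point `u`, with denominators cleared. -/
theorem exists_second_intersection {M : Type*} [AddCommGroup M] [Module A M]
    (Q : QuadraticForm A M) (p g : A) (u r : M) (h : Q (g • u + r) = p * (g * g)) :
    ∃ (g' : A) (f' : M), Q r = g * g' ∧ Q f' = p * (g' * g') := by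
  have h1 : Q (g • u + r) = g * g * Q u + Q r + g * polar Q u r := by
    rw [QuadraticMap.map_add Q, QuadraticMap.map_smul, polar_smul_left]
    simp
  -- On `u + t r` the equation `Q = p` is quadratic in `t`, with root `g⁻¹` and product of roots `(Q
  -- u - p) / Q r`. As `Q r = g * g'`, the other root is `(Q u - p) / g'`.
  refine ⟨p * g - g * Q u - polar Q u r,
    (p * g - g * Q u - polar Q u r) • u + (Q u - p) • r, ?_, ?_⟩
  · linear_combination h - h1
  · have hr : Q r = g * (p * g - g * Q u - polar Q u r) := by linear_combination h - h1
    rw [QuadraticMap.map_add Q, QuadraticMap.map_smul, QuadraticMap.map_smul, polar_smul_left,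
      polar_smul_right, hr]
    simp only [smul_eq_mul]
    ring

end Scalars

/-! ### The Cassels–Pfister theorem -/

section Polynomials

variable {F K ι : Type*} [Field F] [Field K] [Algebra F K] [Fintype ι] {w : ι → F}

theorem coeff_weightedSumSquares (w : ι → F) (f : ι → K[X]) (d : ℕ)
    (hd : ∀ i, (f i).natDegree ≤ d) :
    (weightedSumSquares K[X] w f).coeff (d + d) =
      weightedSumSquares K w (fun i => (f i).coeff d) := by
  simp only [weightedSumSquares_apply, finsetSum_coeff, coeff_smul]
  exact Finset.sum_congr rfl fun i _ => by rw [coeff_mul_add_eq_of_natDegree_le (hd i) (hd i)]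

theorem natDegree_weightedSumSquares_le (w : ι → F) (f : ι → K[X]) (d : ℕ)
    (hd : ∀ i, (f i).natDegree ≤ d) : (weightedSumSquares K[X] w f).natDegree ≤ d + d := by
  rw [weightedSumSquares_apply]
  refine natDegree_sum_le_of_forall_le _ _ fun i _ => ?_
  exact (natDegree_smul_le _ _).trans (natDegree_mul_le_of_le (hd i) (hd i))

/-- Leading terms cannot cancel: if `d` is the largest degree of an entry, the coefficient in degree
`2d` is the value of the form at a nonzero vector. -/
theorem natDegree_le_of_natDegree_weightedSumSquares_le
    (hw : (weightedSumSquares K w).Anisotropic) (f : ι → K[X]) (m : ℕ)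
    (h : (weightedSumSquares K[X] w f).natDegree ≤ m + m) (i : ι) : (f i).natDegree ≤ m := by
  have : Nonempty ι := ⟨i⟩
  obtain ⟨j, hj⟩ := Finite.exists_max fun i => (f i).natDegree
  by_contra hi
  have hm : m < (f j).natDegree := (not_le.mp hi).trans_le (hj i)
  have h0 := coeff_weightedSumSquares w f _ hj
  rw [coeff_eq_zero_of_natDegree_lt (by omega)] at h0
  have h1 : (f j).coeff (f j).natDegree = 0 := congrFun (hw _ h0.symm) j
  rw [coeff_natDegree, leadingCoeff_eq_zero] at h1
  simp [h1] at hm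

theorem anisotropic_polynomial (hw : (weightedSumSquares K w).Anisotropic) :
    (weightedSumSquares K[X] w).Anisotropic := by
  intro f hf
  have hd := natDegree_le_of_natDegree_weightedSumSquares_le hw f 0 (by simp [hf])
  have h0 := coeff_weightedSumSquares w f 0 hd
  rw [hf, coeff_zero] at h0
  funext i
  rw [eq_C_of_natDegree_le_zero (hd i), congrFun (hw _ h0.symm) i]
  simp

theorem exists_clear_denominators (x : ι → RatFunc K) :
    ∃ (g : K[X]) (f : ι → K[X]), g ≠ 0 ∧
      ∀ i, algebraMap K[X] (RatFunc K) (f i) = algebraMap K[X] (RatFunc K) g * x i := by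
  obtain ⟨b, hb⟩ := IsLocalization.exist_integer_multiples_of_finite (nonZeroDivisors K[X]) x
  choose f hf using hb
  exact ⟨b, f, nonZeroDivisors.coe_ne_zero b, fun i => by rw [hf, Algebra.smul_def]⟩

theorem weightedSumSquares_algebraMap_ratFunc (w : ι → F) (f : ι → K[X]) :
    weightedSumSquares (RatFunc K) w (fun i => algebraMap K[X] (RatFunc K) (f i)) =
      algebraMap K[X] (RatFunc K) (weightedSumSquares K[X] w f) :=
  weightedSumSquares_map w (IsScalarTower.toAlgHom F K[X] (RatFunc K)) f

theorem weightedSumSquares_clear_denominators (w : ι → F) {x : ι → RatFunc K} {g : K[X]}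
    {f : ι → K[X]}
    (hf : ∀ i, algebraMap K[X] (RatFunc K) (f i) = algebraMap K[X] (RatFunc K) g * x i) :
    algebraMap K[X] (RatFunc K) (weightedSumSquares K[X] w f) =
      algebraMap K[X] (RatFunc K) (g * g) * weightedSumSquares (RatFunc K) w x := by
  rw [← weightedSumSquares_algebraMap_ratFunc, funext hf]
  exact (QuadraticMap.map_smul (weightedSumSquares (RatFunc K) w)
    (algebraMap K[X] (RatFunc K) g) x).trans (by rw [map_mul, smul_eq_mul])

theorem anisotropic_ratFunc (hw : (weightedSumSquares K w).Anisotropic) :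
    (weightedSumSquares (RatFunc K) w).Anisotropic := by
  intro x hx
  obtain ⟨g, f, hg, hf⟩ := exists_clear_denominators x
  have h := weightedSumSquares_clear_denominators w hf
  rw [hx, mul_zero, map_eq_zero_iff _ (RatFunc.algebraMap_injective K)] at h
  have hf0 := anisotropic_polynomial hw f h
  funext i
  have := hf i
  simp only [hf0, Pi.zero_apply, map_zero] at this
  exact (mul_eq_zero.mp this.symm).resolve_left (RatFunc.algebraMap_ne_zero hg)

/-- The descent in the **Cassels–Pfister theorem**. -/
theorem exists_polynomial_of_mul_sq (hw : (weightedSumSquares K w).Anisotropic) (p : K[X]) :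
    ∀ (n : ℕ) (g : K[X]) (f : ι → K[X]), g.natDegree = n → g ≠ 0 →
      weightedSumSquares K[X] w f = p * (g * g) →
        ∃ y : ι → K[X], weightedSumSquares K[X] w y = p := by
  intro n
  induction n using Nat.strong_induction_on with
  | _ n ih =>
    intro g f hn hg hf
    set u : ι → K[X] := fun i => f i / g
    set r : ι → K[X] := fun i => f i % g
    have hfur : f = g • u + r := by
      funext i
      exact (EuclideanDomain.div_add_mod (f i) g).symm
    by_cases hr : r = 0
    · refine ⟨u, mul_right_cancel₀ (mul_ne_zero hg hg) ?_⟩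
      rw [← hf, hfur, hr, add_zero, QuadraticMap.map_smul, smul_eq_mul, mul_comm]
    · have hn0 : g.natDegree ≠ 0 := by
        intro h0
        refine hr (funext fun i => ?_)
        exact EuclideanDomain.mod_eq_zero.mpr
          ((isUnit_iff_degree_eq_zero.mpr (by rw [degree_eq_natDegree hg, h0]; rfl)).dvd)
      rw [hfur] at hf
      obtain ⟨g', f', hg', hf'⟩ := exists_second_intersection _ p g u r hf
      have hQr : weightedSumSquares K[X] w r ≠ 0 := fun h => hr (anisotropic_polynomial hw _ h)
      have hg'0 : g' ≠ 0 := by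
        rintro rfl
        exact hQr (by rw [hg', mul_zero])
      -- The product `g * g'` has degree at most `2(n - 1)`, so `g'` has degree at most `n - 2` and
      -- the descent makes progress.
      have hdeg := natDegree_weightedSumSquares_le w r (n - 1) fun i => by
        have := natDegree_mod_lt (f i) hn0
        simp only [r]
        omega
      rw [hg', natDegree_mul hg hg'0] at hdeg
      exact ih g'.natDegree (by omega) g' f' rfl hg'0 hf'

/-- The **Cassels–Pfister theorem** for anisotropic diagonal forms. -/
theorem exists_polynomial_of_ratFunc (hw : (weightedSumSquares K w).Anisotropic) (p : K[X])
    (x : ι → RatFunc K)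
    (hx : weightedSumSquares (RatFunc K) w x = algebraMap K[X] (RatFunc K) p) :
    ∃ y : ι → K[X], weightedSumSquares K[X] w y = p := by
  obtain ⟨g, f, hg, hf⟩ := exists_clear_denominators x
  refine exists_polynomial_of_mul_sq hw p _ g f rfl hg (RatFunc.algebraMap_injective K ?_)
  rw [weightedSumSquares_clear_denominators w hf, hx, ← map_mul, mul_comm]

/-- If `⟨a⟩ ⊥ w` is anisotropic and represents `a t² + d` over `K(t)`, then `w` represents `d`. -/
theorem exists_of_ratFunc_cons [NeZero (2 : F)] {n : ℕ} {a : F} {w : Fin n → F}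
    (hw : (weightedSumSquares K (Fin.cons a w : Fin (n + 1) → F)).Anisotropic) (d : K)
    (x : Fin (n + 1) → RatFunc K)
    (hx : weightedSumSquares (RatFunc K) (Fin.cons a w : Fin (n + 1) → F) x =
      algebraMap K[X] (RatFunc K) (a • (X * X) + C d)) :
    ∃ y : Fin n → K, weightedSumSquares K w y = d := by
  obtain ⟨f, hf⟩ := exists_polynomial_of_ratFunc hw _ x hx
  have hdeg := natDegree_le_of_natDegree_weightedSumSquares_le hw f 1 (by
    rw [hf]
    refine natDegree_add_le_of_degree_le ((natDegree_smul_le _ _).trans ?_) (by simp)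
    exact natDegree_mul_le_of_le natDegree_X_le natDegree_X_le) 0
  have h2 : (2 : K) ≠ 0 := by
    rw [← map_ofNat (algebraMap F K) 2]
    exact (map_ne_zero (algebraMap F K)).mpr (NeZero.ne (2 : F))
  -- The first entry is linear, `βX + α`. Solve `βc + α = c`, or `c + α = -c` when `β = 1`;
  -- evaluating at `c` then cancels the term `a c²` on both sides.
  obtain ⟨c, hc⟩ : ∃ c : K, (f 0).eval c * (f 0).eval c = c * c := by
    obtain ⟨β, α, h0⟩ := exists_eq_X_add_C_of_natDegree_le_one hdeg
    rw [h0]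
    by_cases hβ : β = 1
    · refine ⟨-α / 2, ?_⟩
      simp only [hβ, eval_add, eval_mul, eval_C, eval_X]
      field_simp
      ring
    · refine ⟨α / (1 - β), ?_⟩
      have : 1 - β ≠ 0 := sub_ne_zero.mpr (Ne.symm hβ)
      simp only [eval_add, eval_mul, eval_C, eval_X]
      field_simp
      ring
  have he := weightedSumSquares_map (Fin.cons a w : Fin (n + 1) → F)
    ((aeval (R := K) c).restrictScalars F) f
  rw [hf, weightedSumSquares_cons] at he
  simp only [AlgHom.coe_restrictScalars', coe_aeval_eq_eval, hc, eval_add, eval_smul, eval_mul,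
    eval_X, eval_C] at he
  exact ⟨_, add_left_cancel he⟩

end Polynomials

/-! ### Base change of diagonal forms and isometries -/

section BaseChange

variable {F : Type*} [Field F] [Invertible (2 : F)]

theorem baseChange_comp {M N : Type*} [AddCommGroup M] [Module F M] [AddCommGroup N] [Module F N]
    (K : Type*) [Field K] [Algebra F K] (Q : QuadraticForm F N) (f : M →ₗ[F] N) :
    QuadraticForm.baseChange K (Q.comp f) = (QuadraticForm.baseChange K Q).comp
      (f.baseChange K) := by
  ext m
  simp

theorem equivalent_baseChange {M N : Type*} [AddCommGroup M] [Module F M] [AddCommGroup N]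
    [Module F N] (K : Type*) [Field K] [Algebra F K] {Q : QuadraticForm F M}
    {Q' : QuadraticForm F N} (h : Equivalent Q Q') :
    Equivalent (QuadraticForm.baseChange K Q) (QuadraticForm.baseChange K Q') := by
  obtain ⟨e⟩ := h
  have hQ : Q = Q'.comp e.toLinearEquiv.toLinearMap := by
    ext x
    exact (e.map_app x).symm
  rw [hQ, baseChange_comp]
  exact ⟨⟨e.toLinearEquiv.baseChange F K M N, fun _ => rfl⟩⟩

theorem equivalent_baseChange_weightedSumSquares {ι : Type*} [Fintype ι] (K : Type*) [Field K]
    [Algebra F K] (w : ι → F) :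
    Equivalent (QuadraticForm.baseChange K (weightedSumSquares F w)) (weightedSumSquares K w) := by
  classical
  have h : QuadraticForm.baseChange K (weightedSumSquares F w) =
      (weightedSumSquares K w).comp (TensorProduct.piScalarRight F K K ι).toLinearMap := by
    ext m
    simp [Algebra.smul_def]
  rw [h]
  exact ⟨⟨TensorProduct.piScalarRight F K K ι, fun _ => rfl⟩⟩

theorem equivalent_weightedSumSquares_baseChange {ι κ : Type*} [Fintype ι] [Fintype κ] (K : Type*)
    [Field K] [Algebra F K] {w : ι → F} {v : κ → F}
    (h : Equivalent (weightedSumSquares F v) (weightedSumSquares F w)) :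
    Equivalent (weightedSumSquares K v) (weightedSumSquares K w) :=
  ((equivalent_baseChange_weightedSumSquares K v).symm.trans (equivalent_baseChange K h)).trans
    (equivalent_baseChange_weightedSumSquares K w)

theorem exists_eq_of_isometry {ι κ : Type*} [Fintype ι] [Fintype κ] (K : Type*)
    [Field K] [Algebra F K] {w : ι → F} {v : κ → F}
    (f : weightedSumSquares F v →qᵢ weightedSumSquares F w) (y : κ → K) :
    ∃ x : ι → K, weightedSumSquares K w x = weightedSumSquares K v y := by
  obtain ⟨e⟩ := equivalent_baseChange_weightedSumSquares K v
  obtain ⟨e'⟩ := equivalent_baseChange_weightedSumSquares K w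
  have hf : weightedSumSquares F v = (weightedSumSquares F w).comp f.toLinearMap := by
    ext x
    exact (f.map_app x).symm
  refine ⟨e' (f.toLinearMap.baseChange K (e.symm y)), ?_⟩
  rw [e'.map_app, ← e.symm.map_app y]
  have h := baseChange_comp K (weightedSumSquares F w) f.toLinearMap
  rw [← hf] at h
  exact (DFunLike.congr_fun h (e.symm y)).symm

theorem anisotropic_of_equivalent {R M N : Type*} [CommRing R] [AddCommGroup M] [Module R M]
    [AddCommGroup N] [Module R N] {Q : QuadraticForm R M} {Q' : QuadraticForm R N}
    (h : Equivalent Q Q') (hQ : Q.Anisotropic) : Q'.Anisotropic := by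
  obtain ⟨e⟩ := h
  intro x hx
  have := hQ (e.symm x) (by rw [e.symm.map_app, hx])
  simpa using congrArg e this

theorem exists_eq_of_equivalent {R M N : Type*} [CommRing R] [AddCommGroup M] [Module R M]
    [AddCommGroup N] [Module R N] {Q : QuadraticForm R M} {Q' : QuadraticForm R N}
    (h : Equivalent Q Q') (x : M) : ∃ y, Q' y = Q x := by
  obtain ⟨e⟩ := h
  exact ⟨e x, e.map_app x⟩

end BaseChange

/-! ### Orthogonal splitting -/

section Splitting

variable {F V : Type*} [Field F] [Invertible (2 : F)] [AddCommGroup V] [Module F V]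

/-- A vector of nonzero norm splits off. -/
theorem exists_equivalent_cons [FiniteDimensional F V] (Q : QuadraticForm F V) {x : V}
    (hx : Q x ≠ 0) : ∃ (m : ℕ) (w : Fin m → F),
      Equivalent Q (weightedSumSquares F (Fin.cons (Q x) w : Fin (m + 1) → F)) := by
  set B : LinearMap.BilinForm F V := associated (R := F) Q with hB
  have hsymm : LinearMap.IsSymm B := associated_isSymm F Q
  have hBx : B x x ≠ 0 := by rwa [hB, associated_eq_self_apply]
  have hc := LinearMap.isCompl_span_singleton_orthogonal hBx
  let B' := B.domRestrict₁₂ ((F ∙ x).orthogonalBilin B) ((F ∙ x).orthogonalBilin B)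
  obtain ⟨v, hv⟩ := LinearMap.BilinForm.exists_orthogonal_basis
    (hsymm.domRestrict _ : LinearMap.IsSymm B')
  let b := Basis.mkFinCons x v
    (by
      intro c y hy h0
      rw [add_eq_zero_iff_neg_eq] at h0
      rw [← h0, Submodule.neg_mem_iff] at hy
      have := Submodule.disjoint_def.mp hc.disjoint (c • x)
        (Submodule.smul_mem _ _ <| Submodule.mem_span_singleton_self _) hy
      exact (smul_eq_zero.1 this).resolve_right fun h => hBx <| h.symm ▸ map_zero _)
    (by
      intro y
      refine ⟨-B x y / B x x, fun z hz => ?_⟩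
      obtain ⟨c, rfl⟩ := Submodule.mem_span_singleton.1 hz
      rw [map_smul, LinearMap.smul_apply, map_add, map_smul, smul_eq_mul, smul_eq_mul,
        div_mul_cancel₀ _ hBx, add_neg_cancel, mul_zero])
  have hb : B.IsOrthoᵢ b := by
    rw [Basis.coe_mkFinCons]
    intro j i
    refine Fin.cases ?_ (fun i => ?_) i <;> refine Fin.cases ?_ (fun j => ?_) j <;> intro hij <;>
      simp only [Function.onFun, Fin.cons_zero, Fin.cons_succ, Function.comp_apply]
    · exact (hij rfl).elim
    · rw [← hsymm.eq]
      exact (v j).prop _ (Submodule.mem_span_singleton_self x)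
    · exact (v i).prop _ (Submodule.mem_span_singleton_self x)
    · exact hv (ne_of_apply_ne _ hij)
  refine ⟨_, fun i => Q (v i), ?_⟩
  have hcons : (Fin.cons (Q x) fun i => Q (v i) : Fin _ → F) = fun i => Q (b i) := by
    funext i
    rw [Basis.coe_mkFinCons]
    refine Fin.cases ?_ (fun i => ?_) i <;> simp
  rw [hcons, ← basisRepr_eq_of_iIsOrtho Q b hb]
  exact ⟨Q.isometryEquivBasisRepr b⟩

/-- A proper subspace of an anisotropic space has a nonzero orthogonal vector. -/
theorem exists_ne_zero_orthogonal [FiniteDimensional F V] {Q : QuadraticForm F V}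
    (hQ : Q.Anisotropic) {U : Submodule F V} (hU : U ≠ ⊤) :
    ∃ x : V, x ≠ 0 ∧ ∀ y ∈ U, polar Q y x = 0 := by
  set B : LinearMap.BilinForm F V := polarBilin Q with hB
  have hrefl : B.IsRefl := fun y z h => by
    simpa [hB, polar_comm] using h
  -- A vector of `U` orthogonal to `U` is orthogonal to itself, hence isotropic because `2` is
  -- invertible.
  have hd : Disjoint U (B.orthogonal U) := by
    refine Submodule.disjoint_def.mpr fun y hy hy' => hQ y ?_
    have := LinearMap.BilinForm.mem_orthogonal_iff.mp hy' y hy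
    have h2 : (2 : F) * Q y = 0 := by
      simpa [hB, polar_self, two_smul, two_mul] using this
    exact (mul_eq_zero.mp h2).resolve_left (Invertible.ne_zero 2)
  have hc := (LinearMap.BilinForm.isCompl_orthogonal_iff_disjoint hrefl).mpr hd
  have : B.orthogonal U ≠ ⊥ := fun h => hU (by simpa [h] using hc.sup_eq_top)
  obtain ⟨x, hx, hx0⟩ := Submodule.exists_mem_ne_zero_of_ne_bot this
  exact ⟨x, hx0, fun y hy => LinearMap.BilinForm.mem_orthogonal_iff.mp hx y hy⟩

end Splitting

/-! ### Pfister's subform theorem -/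

section Subform

variable {F : Type u} [Field F] [Invertible (2 : F)]

/-- **Pfister's subform theorem**: if, over all fields in a class of extensions of `F` that
contains `F` and is closed under passing to rational function fields, `w` stays anisotropic and
represents all the values of `v`, then `v` is a subform of `w`. -/
theorem nonempty_isometry_of_values (P : ∀ (K : Type u) [Field K] [Algebra F K], Prop) (hF : P F)
    (hP : ∀ (K : Type u) [Field K] [Algebra F K], P K → P (RatFunc K)) :
    ∀ (n : ℕ) (v : Fin n → F) (_ : ∀ i, v i ≠ 0) (m : ℕ) (w : Fin m → F)
      (_ : ∀ (K : Type u) [Field K] [Algebra F K], P K → (weightedSumSquares K w).Anisotropic)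
      (_ : ∀ (K : Type u) [Field K] [Algebra F K], P K → ∀ y : Fin n → K,
        ∃ x : Fin m → K, weightedSumSquares K w x = weightedSumSquares K v y),
      Nonempty (weightedSumSquares F v →qᵢ weightedSumSquares F w) := by
  have : NeZero (2 : F) := ⟨Invertible.ne_zero 2⟩
  intro n
  induction n with
  | zero => exact fun v _ m w _ _ => ⟨⟨0, fun x => by simp⟩⟩
  | succ n ih =>
    intro v hv m w hw H
    obtain ⟨a, v, rfl⟩ : ∃ a v', v = Fin.cons a v' := ⟨v 0, Fin.tail v, (Fin.cons_self_tail v).symm⟩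
    obtain ⟨x, hx⟩ := H F hF (Fin.cons 1 0)
    replace hx : weightedSumSquares F w x = a := by
      rw [hx, weightedSumSquares_cons]
      simp
    obtain ⟨k, w', he⟩ := exists_equivalent_cons (weightedSumSquares F w) (x := x)
      (by rw [hx]; exact hv 0)
    rw [hx] at he
    have hcons : ∀ (K : Type u) [Field K] [Algebra F K], P K →
        (weightedSumSquares K (Fin.cons a w' : Fin (k + 1) → F)).Anisotropic :=
      fun K _ _ hK => anisotropic_of_equivalent (equivalent_weightedSumSquares_baseChange K he) (hw K hK)
    obtain ⟨f⟩ := ih v (fun i => hv i.succ) k w'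
      (fun K _ _ hK y hy => by
        have h0 := hcons K hK (Fin.cons 0 y) (by
          rw [weightedSumSquares_cons, Fin.tail_cons, hy]
          simp)
        exact (Fin.tail_cons (α := fun _ => K) 0 y).symm.trans (congrArg Fin.tail h0))
      (fun K _ _ hK y => by
        -- At the vector `(t, y)` the form `⟨a⟩ ⊥ v` takes the value `a t² + v(y)`. Since `⟨a⟩ ⊥ w'`
        -- represents it over `K(t)`, Cassels–Pfister makes `w'` represent `v(y)` over `K`.
        obtain ⟨x, hx⟩ := H (RatFunc K) (hP K hK)
          (Fin.cons (algebraMap K[X] (RatFunc K) X) fun i => algebraMap K[X] (RatFunc K) (C (y i)))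
        obtain ⟨x', hx'⟩ :=
          exists_eq_of_equivalent (equivalent_weightedSumSquares_baseChange (RatFunc K) he) x
        refine exists_of_ratFunc_cons (hcons K hK) _ x' ?_
        rw [hx', hx, weightedSumSquares_cons, Fin.tail_cons, weightedSumSquares_algebraMap_ratFunc,
          Fin.cons_zero, map_add, Algebra.smul_def, Algebra.smul_def]
        simp only [map_mul]
        rw [← IsScalarTower.algebraMap_apply F K[X] (RatFunc K)]
        exact congrArg _ (congrArg _ (weightedSumSquares_map v (IsScalarTower.toAlgHom F K K[X]) y)))
    obtain ⟨e⟩ := he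
    -- The identity on `⟨a⟩` together with the embedding of `v` in `w'`.
    let g : (Fin (n + 1) → F) →ₗ[F] (Fin (k + 1) → F) :=
      { toFun := fun y => Fin.cons (y 0) (f (Fin.tail y))
        map_add' := fun y z => by
          funext i
          refine Fin.cases ?_ (fun i => ?_) i
          · simp
          · exact congrFun (f.toLinearMap.map_add (Fin.tail y) (Fin.tail z)) i
        map_smul' := fun c y => by
          funext i
          refine Fin.cases ?_ (fun i => ?_) i
          · simp
          · exact congrFun (f.toLinearMap.map_smul c (Fin.tail y)) i }
    refine ⟨⟨e.symm.toLinearEquiv.toLinearMap ∘ₗ g, fun y => ?_⟩⟩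
    refine (e.symm.map_app (g y)).trans ?_
    simp only [g, LinearMap.coe_mk, AddHom.coe_mk]
    rw [weightedSumSquares_cons, weightedSumSquares_cons, Fin.tail_cons, f.map_app, Fin.cons_zero]

end Subform

/-! ### Similarity factors and roundness -/

section Round

variable {K M N : Type*} [Field K] [AddCommGroup M] [Module K M] [AddCommGroup N] [Module K N]

/-- Every nonzero value of `Q` is a similarity factor of `Q`. -/
def HasSimilarValues (Q : QuadraticForm K M) : Prop :=
  ∀ x, Q x ≠ 0 → Equivalent (Q x • Q) Q

theorem equivalent_smul {Q : QuadraticForm K M} {Q' : QuadraticForm K N} (c : K)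
    (h : Equivalent Q Q') : Equivalent (c • Q) (c • Q') := by
  obtain ⟨e⟩ := h
  exact ⟨⟨e.toLinearEquiv, fun x => congrArg (c • ·) (e.map_app x)⟩⟩

theorem equivalent_mul_self_smul (Q : QuadraticForm K M) {a : K} (ha : a ≠ 0) :
    Equivalent ((a * a) • Q) Q :=
  ⟨⟨LinearEquiv.smulOfNeZero K M a ha, fun x => by
    simpa using QuadraticMap.map_smul Q a x⟩⟩

theorem HasSimilarValues.of_equivalent {Q : QuadraticForm K M} {Q' : QuadraticForm K N}
    (h : Equivalent Q Q') (hQ : HasSimilarValues Q) : HasSimilarValues Q' := by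
  intro x hx
  obtain ⟨y, hy⟩ := exists_eq_of_equivalent h.symm x
  rw [← hy] at hx ⊢
  exact ((equivalent_smul _ h.symm).trans (hQ y hx)).trans h

theorem smul_prod (c : K) (Q : QuadraticForm K M) (Q' : QuadraticForm K N) :
    c • Q.prod Q' = (c • Q).prod (c • Q') := by
  ext x
  simp [mul_add]

/-- This is `⟨a, b⟩ ≃ ⟨a + b, ab(a + b)⟩` tensored with `Q`: the vectors `(1, 1)` and `(b, -a)` form
an orthogonal basis of `⟨a, b⟩` with these values. -/
theorem equivalent_prod_add (Q : QuadraticForm K M) {a b : K} (hab : a + b ≠ 0) :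
    Equivalent (((a + b) • Q).prod (((a + b) * (a * b)) • Q)) ((a • Q).prod (b • Q)) := by
  let e : (M × M) ≃ₗ[K] (M × M) :=
    { toFun := fun x => (x.1 + b • x.2, x.1 - a • x.2)
      invFun := fun x => ((a + b)⁻¹ • (a • x.1 + b • x.2), (a + b)⁻¹ • (x.1 - x.2))
      map_add' := fun x y => by ext <;> simp <;> module
      map_smul' := fun c x => by ext <;> simp <;> module
      left_inv := fun x => by
        ext
        · simp only
          rw [inv_smul_eq_iff₀ hab]
          module
        · simp only
          rw [inv_smul_eq_iff₀ hab]
          module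
      right_inv := fun x => by
        ext
        · simp only
          rw [smul_comm b, ← smul_add, inv_smul_eq_iff₀ hab]
          module
        · simp only
          rw [smul_comm a, ← smul_sub, inv_smul_eq_iff₀ hab]
          module }
  refine ⟨⟨e, fun x => ?_⟩⟩
  change a • Q (x.1 + b • x.2) + b • Q (x.1 - a • x.2) = (a + b) • Q x.1 +
    ((a + b) * (a * b)) • Q x.2
  rw [sub_eq_add_neg, ← neg_smul, QuadraticMap.map_add Q, QuadraticMap.map_add Q,
    QuadraticMap.map_smul, QuadraticMap.map_smul, polar_smul_right, polar_smul_right]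
  simp only [smul_eq_mul]
  ring

/-- Let `c = s + at` with `s`, `t` values of `Q`. If both are nonzero, then `c(Q ⊥ aQ) ≃ cQ ⊥
c·s·at·Q ≃ sQ ⊥ atQ ≃ Q ⊥ aQ`, using `stQ ≃ Q` first and `sQ ≃ Q ≃ tQ` last. If one vanishes, `c` is
`s` or `at`; multiplication by `a` swaps the summands up to the square `a²`. -/
theorem HasSimilarValues.prod_smul {Q : QuadraticForm K M} (hQ : HasSimilarValues Q) {a : K}
    (ha : a ≠ 0) : HasSimilarValues (Q.prod (a • Q)) := by
  intro x hx
  have hval : Q.prod (a • Q) x = Q x.1 + a * Q x.2 := by simp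
  rw [hval] at hx ⊢
  by_cases h2 : Q x.2 = 0
  · rw [h2, mul_zero, add_zero] at hx ⊢
    rw [smul_prod, smul_comm]
    exact (hQ _ hx).prod (equivalent_smul a (hQ _ hx))
  · by_cases h1 : Q x.1 = 0
    · rw [h1, zero_add, smul_prod, smul_smul, mul_right_comm, mul_smul, mul_smul]
      refine (Equivalent.prod (equivalent_smul a (hQ _ h2)) ?_).trans
        ⟨IsometryEquiv.prodComm _ _⟩
      exact (equivalent_mul_self_smul _ ha).trans (hQ _ h2)
    · have h12 : Equivalent ((Q x.1 * Q x.2) • Q) Q := by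
        rw [mul_smul]
        exact (equivalent_smul _ (hQ _ h2)).trans (hQ _ h1)
      have hleft : Equivalent ((Q x.1 + a * Q x.2) • Q.prod (a • Q))
          (((Q x.1 + a * Q x.2) • Q).prod
            (((Q x.1 + a * Q x.2) * (Q x.1 * (a * Q x.2))) • Q)) := by
        rw [smul_prod, mul_left_comm (Q x.1), mul_smul _ (a * _), mul_smul a]
        exact (Equivalent.refl _).prod (equivalent_smul _ (equivalent_smul _ h12.symm))
      refine (hleft.trans (equivalent_prod_add Q hx)).trans ?_
      rw [mul_smul]
      exact (hQ _ h1).prod (equivalent_smul _ (hQ _ h2))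

theorem HasSimilarValues.isRound {Q : QuadraticForm K M} (hQ : HasSimilarValues Q)
    (h1 : ∃ x, Q x = 1) : IsRound Q := by
  have heq : valueSet Q = similarityFactors Q := by
    ext c
    constructor
    · rintro ⟨x, hx⟩
      have := hQ x (by rw [hx]; exact c.ne_zero)
      rwa [hx] at this
    · intro hc
      obtain ⟨x, hx⟩ := h1
      obtain ⟨y, hy⟩ := exists_eq_of_equivalent hc x
      exact ⟨y, by rw [hy]; simp [hx]⟩
  refine ⟨⟨{ carrier := similarityFactors Q, mul_mem' := ?_, one_mem' := ?_, inv_mem' := ?_ }, ?_⟩,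
    heq⟩
  · intro a b ha hb
    change Equivalent (((a * b : Kˣ) : K) • Q) Q
    rw [Units.val_mul, mul_smul]
    exact (equivalent_smul _ hb).trans ha
  · change Equivalent (((1 : Kˣ) : K) • Q) Q
    rw [Units.val_one, one_smul]
  · intro a ha
    have := (equivalent_smul ((a⁻¹ : Kˣ) : K) ha).symm
    rwa [← mul_smul, Units.inv_mul, one_smul] at this
  · exact heq.symm

end Round

/-! ### Pfister forms as diagonal forms -/

section PfisterWeights

variable {F : Type u} [Field F]

/-- `IsPfisterWeights l w` says that `w` is the family of diagonal entries of the form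
`⟨1, a₁⟩ ⊗ ⋯ ⊗ ⟨1, aₙ⟩`, where `l = [a₁, …, aₙ]`. -/
inductive IsPfisterWeights : List Fˣ → ∀ {ι : Type} [Fintype ι], (ι → F) → Prop
  | nil : IsPfisterWeights [] (fun _ : Unit => (1 : F))
  | cons (a : Fˣ) {l : List Fˣ} {ι : Type} [Fintype ι] {w : ι → F} (h : IsPfisterWeights l w) :
      IsPfisterWeights (a :: l) (Sum.elim w ((a : F) • w))

theorem exists_isPfisterWeights (l : List Fˣ) :
    ∃ (ι : Type) (_ : Fintype ι) (w : ι → F), IsPfisterWeights l w := by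
  induction l with
  | nil => exact ⟨_, _, _, .nil⟩
  | cons a l ih =>
    obtain ⟨ι, _, w, h⟩ := ih
    exact ⟨_, _, _, h.cons a⟩

namespace IsPfisterWeights

variable {l : List Fˣ} {ι : Type} [Fintype ι] {w : ι → F}

theorem card_eq (h : IsPfisterWeights l w) : Fintype.card ι = 2 ^ l.length := by
  induction h with
  | nil => simp
  | cons a h ih => rw [Fintype.card_sum, ih, List.length_cons, pow_succ, mul_two]

theorem ne_zero (h : IsPfisterWeights l w) (i : ι) : w i ≠ 0 := by
  induction h with
  | nil => exact one_ne_zero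
  | cons a h ih =>
    rcases i with i | i
    · exact ih i
    · exact mul_ne_zero a.ne_zero (ih i)

theorem exists_eq_one (h : IsPfisterWeights l w) (K : Type*) [Field K] [Algebra F K] :
    ∃ x, weightedSumSquares K w x = 1 := by
  induction h with
  | nil => exact ⟨fun _ => 1, by simp⟩
  | cons a h ih =>
    obtain ⟨x, hx⟩ := ih
    refine ⟨Sum.elim x 0, ?_⟩
    rw [weightedSumSquares_elim]
    simpa using hx

theorem _root_.QuadraticForm.equivalent_weightedSumSquares_elim_smul (K : Type*) [Field K]
    [Algebra F K] (w : ι → F) (a : F) :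
    Equivalent ((weightedSumSquares K w).prod (algebraMap F K a • weightedSumSquares K w))
      (weightedSumSquares K (Sum.elim w (a • w))) := by
  refine ⟨⟨(LinearEquiv.sumArrowLequivProdArrow ι ι K K).symm, fun x => ?_⟩⟩
  refine (weightedSumSquares_elim _ _ _).trans ?_
  rw [weightedSumSquares_smul, Algebra.smul_def]
  rfl

theorem hasSimilarValues (h : IsPfisterWeights l w) (K : Type*) [Field K] [Algebra F K] :
    HasSimilarValues (weightedSumSquares K w) := by
  induction h with
  | nil =>
    intro x hx
    have h0 : weightedSumSquares K (fun _ : Unit => (1 : F)) x = x () * x () := by simp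
    rw [h0] at hx ⊢
    exact equivalent_mul_self_smul _ (left_ne_zero_of_mul hx)
  | cons a h ih =>
    exact (ih.prod_smul (by simp)).of_equivalent (equivalent_weightedSumSquares_elim_smul K _ _)

/-- The standard basis of `⟨1, a⟩` is orthogonal, so the two copies of `M` it spans in the tensor
product are orthogonal too. -/
theorem _root_.QuadraticForm.equivalent_tmul_binary [Invertible (2 : F)] {M : Type*}
    [AddCommGroup M] [Module F M] (Q : QuadraticForm F M) (a : F) :
    Equivalent (Q.prod (a • Q))
      (QuadraticForm.tmul (weightedSumSquares F ![(1 : F), a]) Q) := by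
  let e : (M × M) ≃ₗ[F] (Fin 2 → F) ⊗[F] M :=
    ((TensorProduct.comm F (Fin 2 → F) M ≪≫ₗ TensorProduct.piScalarRight F F M (Fin 2)) ≪≫ₗ
      LinearEquiv.finTwoArrow F M).symm
  have he : ∀ x : M × M, e x = (Pi.single 0 1 : Fin 2 → F) ⊗ₜ[F] x.1 +
      (Pi.single 1 1 : Fin 2 → F) ⊗ₜ[F] x.2 := by
    intro x
    rw [LinearEquiv.symm_apply_eq]
    ext <;> simp [LinearEquiv.finTwoArrow]
  have hpolar : polarBilin (weightedSumSquares F ![(1 : F), a]) (Pi.single 0 1) (Pi.single 1 1) =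
      0 := by
    simp [polar, Fin.sum_univ_two]
  refine ⟨⟨e, fun x => ?_⟩⟩
  refine (congrArg _ (he x)).trans ?_
  rw [QuadraticMap.map_add (QuadraticForm.tmul _ Q), ← polarBilin_apply_apply, polarBilin_tmul]
  simp [hpolar, Fin.sum_univ_two, mul_comm]

theorem equivalent_pfisterForm [Invertible (2 : F)] (h : IsPfisterWeights l w) :
    Equivalent (pfisterForm l).form (weightedSumSquares F w) := by
  induction h with
  | nil =>
    have h : Equivalent (weightedSumSquares F ![(1 : F)])
        (weightedSumSquares F fun _ : Unit => (1 : F)) := by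
      refine ⟨⟨LinearEquiv.funCongrLeft F F (Equiv.ofUnique Unit (Fin 1)), fun x => ?_⟩⟩
      simp only [weightedSumSquares_apply, Finset.univ_unique, Finset.sum_singleton]
      rfl
    exact h
  | cons a h ih =>
    refine (equivalent_tmul_binary _ _).symm.trans ?_
    exact (ih.prod (equivalent_smul _ ih)).trans (equivalent_weightedSumSquares_elim_smul F _ _)

end IsPfisterWeights

end PfisterWeights

/-! ### From group forms to Pfister forms -/

section Converse

theorem polar_weightedSumSquares {F ι : Type*} [Field F] [Fintype ι] (w : ι → F) (x y : ι → F) :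
    polar (weightedSumSquares F w) x y = 2 * ∑ i, w i * (x i * y i) := by
  simp only [polar, weightedSumSquares_apply, Pi.add_apply, smul_eq_mul]
  rw [← Finset.sum_sub_distrib, ← Finset.sum_sub_distrib, Finset.mul_sum]
  exact Finset.sum_congr rfl fun i _ => by ring

/-- The kernel lies in the radical of the source, which is zero for nonzero weights. -/
theorem injective_of_isometry {F ι V : Type*} [Field F] [Invertible (2 : F)] [Fintype ι]
    [AddCommGroup V] [Module F V] {w : ι → F} (hw : ∀ i, w i ≠ 0) {Q : QuadraticForm F V}
    (f : weightedSumSquares F w →qᵢ Q) : Function.Injective f.toLinearMap := by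
  classical
  rw [injective_iff_map_eq_zero]
  intro x hx
  funext i
  have hp : polar (weightedSumSquares F w) x (Pi.single i 1) = 0 := by
    have hx' : f x = 0 := hx
    have h1 : f (x + Pi.single i 1) = f x + f (Pi.single i 1) := f.toLinearMap.map_add _ _
    simp only [polar]
    rw [← f.map_app, ← f.map_app x, ← f.map_app (Pi.single i 1), h1, hx']
    simp
  rw [polar_weightedSumSquares] at hp
  simpa [Pi.single_apply, hw i, Invertible.ne_zero (2 : F)] using hp

variable {F : Type u} [Field F]

/-- An isometric embedding extends along a vector orthogonal to its image. -/
theorem nonempty_isometry_elim {V ι : Type*} [AddCommGroup V] [Module F V] [Fintype ι] {w : ι → F}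
    {Q : QuadraticForm F V} (f : weightedSumSquares F w →qᵢ Q) {x₀ : V}
    (horth : ∀ y, polar Q (f y) x₀ = 0) :
    Nonempty (weightedSumSquares F (Sum.elim w fun _ : Unit => Q x₀) →qᵢ Q) := by
  refine ⟨⟨f.toLinearMap ∘ₗ LinearMap.funLeft F F Sum.inl +
        (LinearMap.proj (Sum.inr ())).smulRight x₀, fun y => ?_⟩⟩
  change Q (f (y ∘ Sum.inl) + y (Sum.inr ()) • x₀) = _
  rw [QuadraticMap.map_add Q, polar_smul_right, horth, QuadraticMap.map_smul, f.map_app,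
    weightedSumSquares_elim]
  simp [mul_comm]

theorem weightedSumSquares_comp_equiv {A ι κ : Type*} [CommRing A] [Algebra F A] [Fintype ι]
    [Fintype κ] (e : κ ≃ ι) (w : ι → F) (x : ι → A) :
    weightedSumSquares A (w ∘ e) (x ∘ e) = weightedSumSquares A w x := by
  simp only [weightedSumSquares_apply]
  exact Fintype.sum_equiv e _ _ fun i => rfl

variable [Invertible (2 : F)]

theorem nonempty_isometry_of_forall_anisotropic {m : ℕ} {q : Fin m → F}
    (hq : (weightedSumSquares F q).Anisotropic) {κ : Type*} [Fintype κ] {v : κ → F}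
    (hv : ∀ i, v i ≠ 0)
    (hval : ∀ (K : Type u) [Field K] [Algebra F K] (y : κ → K), ∃ x : Fin m → K,
      weightedSumSquares K q x = weightedSumSquares K v y) :
    Nonempty (weightedSumSquares F v →qᵢ weightedSumSquares F q) := by
  let e := Fintype.equivFin κ
  have hP : ∀ (K : Type u) [Field K] [Algebra F K], (weightedSumSquares K q).Anisotropic →
      (weightedSumSquares (RatFunc K) q).Anisotropic :=
    fun K _ _ hK => anisotropic_ratFunc (F := F) (K := K) (w := q) hK
  have hval' : ∀ (K : Type u) [Field K] [Algebra F K] (y : Fin (Fintype.card κ) → K),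
      ∃ x : Fin m → K, weightedSumSquares K q x = weightedSumSquares K (v ∘ e.symm) y := by
    intro K _ _ y
    obtain ⟨x, hx⟩ := hval K (y ∘ e)
    refine ⟨x, hx.trans ?_⟩
    rw [← weightedSumSquares_comp_equiv e.symm v (y ∘ e), Function.comp_assoc,
      Equiv.self_comp_symm, Function.comp_id]
  -- An anisotropic form stays anisotropic over `K(t)`, so this class of extensions is closed as the
  -- subform theorem requires.
  let P : ∀ (K : Type u) [Field K] [Algebra F K], Prop :=
    fun K _ _ => (weightedSumSquares K q).Anisotropic
  have hF : P F := hq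
  have hP' : ∀ (K : Type u) [Field K] [Algebra F K], P K → P (RatFunc K) := hP
  obtain ⟨k⟩ := nonempty_isometry_of_values P hF hP' (Fintype.card κ) (v ∘ e.symm)
    (fun i => hv (e.symm i)) m q (fun K _ _ hK => hK) (fun K _ _ _ => hval' K)
  exact ⟨k.comp ⟨LinearMap.funLeft F F e.symm, weightedSumSquares_comp_equiv e.symm v⟩⟩

/-- An anisotropic form whose values over every extension are closed under multiplication contains
with every proper Pfister subform a Pfister subform of twice the dimension. -/
theorem IsPfisterWeights.exists_cons {m : ℕ} {q : Fin m → F}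
    (hq : (weightedSumSquares F q).Anisotropic)
    (hmul : ∀ (K : Type u) [Field K] [Algebra F K] (x y : Fin m → K), ∃ z,
      weightedSumSquares K q z = weightedSumSquares K q x * weightedSumSquares K q y)
    {l : List Fˣ} {ι : Type} [Fintype ι] {w : ι → F} (h : IsPfisterWeights l w)
    (f : weightedSumSquares F w →qᵢ weightedSumSquares F q)
    (hf : LinearMap.range f.toLinearMap ≠ ⊤) :
    ∃ a : Fˣ, Nonempty
      (weightedSumSquares F (Sum.elim w ((a : F) • w)) →qᵢ weightedSumSquares F q) := by
  obtain ⟨x₀, hx₀, horth⟩ := exists_ne_zero_orthogonal hq hf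
  obtain ⟨a, ha⟩ : ∃ a : Fˣ, (a : F) = weightedSumSquares F q x₀ :=
    ⟨Units.mk0 _ fun h0 => hx₀ (hq _ h0), rfl⟩
  refine ⟨a, ?_⟩
  obtain ⟨g⟩ := nonempty_isometry_elim f
    fun y => horth _ (LinearMap.mem_range_self f.toLinearMap y)
  rw [← ha] at g
  have hval : ∀ (K : Type u) [Field K] [Algebra F K] (y : ι ⊕ ι → K), ∃ x : Fin m → K,
      weightedSumSquares K q x = weightedSumSquares K (Sum.elim w ((a : F) • w)) y := by
    intro K _ _ y
    rw [weightedSumSquares_elim, weightedSumSquares_smul]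
    by_cases h0 : weightedSumSquares K w (y ∘ Sum.inr) = 0
    · rw [h0, smul_zero, add_zero]
      exact exists_eq_of_isometry K f _
    -- With `c = w(y₂) ≠ 0`, similarity gives `w(y₁) = c w(z)`, so `w(y₁) + a w(y₂) = c (w(z) + a)`:
    -- a value of `w` times a value of `w ⊥ ⟨a⟩`, both values of `q`.
    · obtain ⟨z, hz⟩ := exists_eq_of_equivalent (h.hasSimilarValues K _ h0).symm (y ∘ Sum.inl)
      obtain ⟨x₁, hx₁⟩ := exists_eq_of_isometry K g (Sum.elim z fun _ => 1)
      obtain ⟨x₂, hx₂⟩ := exists_eq_of_isometry K f (y ∘ Sum.inr)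
      obtain ⟨x, hx⟩ := hmul K x₂ x₁
      refine ⟨x, ?_⟩
      rw [hx, hx₁, hx₂, weightedSumSquares_elim, ← hz, Sum.elim_comp_inl, Sum.elim_comp_inr,
        mul_add]
      simp only [_root_.smul_apply, smul_eq_mul]
      congr 1
      simp [Algebra.smul_def, mul_comm]
  exact nonempty_isometry_of_forall_anisotropic hq (h.cons a).ne_zero hval

/-- **Pfister's theorem**: an anisotropic form that represents `1` and whose values over every
extension are closed under multiplication is a Pfister form. -/
theorem isPfister_of_values_mul {m : ℕ} {q : Fin m → F}
    (hq : (weightedSumSquares F q).Anisotropic) (h1 : ∃ x, weightedSumSquares F q x = 1)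
    (hmul : ∀ (K : Type u) [Field K] [Algebra F K] (x y : Fin m → K), ∃ z,
      weightedSumSquares K q z = weightedSumSquares K q x * weightedSumSquares K q y) :
    IsPfister (weightedSumSquares F q) := by
  by_contra hne
  -- If `q` is not Pfister, no embedded Pfister form fills it, so doubling never stops; `n = m`
  -- contradicts `m < 2 ^ m`.
  have key : ∀ n : ℕ, ∃ (l : List Fˣ) (ι : Type) (_ : Fintype ι) (w : ι → F), l.length = n ∧
      IsPfisterWeights l w ∧ Nonempty (weightedSumSquares F w →qᵢ weightedSumSquares F q) := by
    intro n
    induction n with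
    | zero =>
      obtain ⟨x, hx⟩ := h1
      refine ⟨[], Unit, inferInstance, _, rfl, .nil,
        ⟨⟨(LinearMap.proj ()).smulRight x, fun y => ?_⟩⟩⟩
      change weightedSumSquares F q (y () • x) = _
      rw [QuadraticMap.map_smul, hx]
      simp
    | succ n ih =>
      obtain ⟨l, ι, _, w, hl, hw, ⟨f⟩⟩ := ih
      have hf : LinearMap.range f.toLinearMap ≠ ⊤ := by
        intro htop
        refine hne ⟨l, (hw.equivalent_pfisterForm.trans ⟨⟨LinearEquiv.ofBijective f.toLinearMap
          ⟨injective_of_isometry hw.ne_zero f, LinearMap.range_eq_top.mp htop⟩, ?_⟩⟩).symm⟩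
        exact f.map_app
      obtain ⟨a, hg⟩ := hw.exists_cons hq hmul f hf
      exact ⟨a :: l, _, _, _, by rw [List.length_cons, hl], hw.cons a, hg⟩
  obtain ⟨l, ι, _, w, hl, hw, ⟨f⟩⟩ := key m
  have := LinearMap.finrank_le_finrank_of_injective (injective_of_isometry hw.ne_zero f)
  rw [finrank_fintype_fun_eq_card, finrank_fintype_fun_eq_card, Fintype.card_fin, hw.card_eq,
    hl] at this
  exact absurd this (not_le.mpr m.lt_two_pow_self)

end Converse

/-! ### Value sets of group forms and the equivalence -/

theorem valueSet_eq_of_equivalent {F M N : Type*} [Field F] [AddCommGroup M] [Module F M]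
    [AddCommGroup N] [Module F N] {Q : QuadraticForm F M} {Q' : QuadraticForm F N}
    (h : Equivalent Q Q') : valueSet Q = valueSet Q' := by
  ext a
  constructor
  · rintro ⟨x, hx⟩
    obtain ⟨y, hy⟩ := exists_eq_of_equivalent h x
    exact ⟨y, hy.trans hx⟩
  · rintro ⟨x, hx⟩
    obtain ⟨y, hy⟩ := exists_eq_of_equivalent h.symm x
    exact ⟨y, hy.trans hx⟩

theorem IsGroupForm.exists_eq_mul {F M : Type*} [Field F] [AddCommGroup M] [Module F M]
    {Q : QuadraticForm F M} (hQ : IsGroupForm Q) (x y : M) : ∃ z, Q z = Q x * Q y := by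
  obtain ⟨H, hH⟩ := hQ
  by_cases hx : Q x = 0
  · exact ⟨x, by rw [hx, zero_mul]⟩
  by_cases hy : Q y = 0
  · exact ⟨y, by rw [hy, mul_zero]⟩
  have hmem : ∀ a, a ∈ H ↔ a ∈ valueSet Q := fun a => by rw [← hH]; rfl
  exact (hmem _).mp (mul_mem ((hmem (Units.mk0 _ hx)).mpr ⟨x, rfl⟩)
    ((hmem (Units.mk0 _ hy)).mpr ⟨y, rfl⟩))

theorem IsGroupForm.exists_eq_one {F M : Type*} [Field F] [AddCommGroup M] [Module F M]
    {Q : QuadraticForm F M} (hQ : IsGroupForm Q) : ∃ x, Q x = 1 := by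
  obtain ⟨H, hH⟩ := hQ
  have : (1 : Fˣ) ∈ (H : Set Fˣ) := one_mem H
  rwa [hH] at this

end QuadraticForm

theorem corollary6 {F : Type u} [Field F] [Invertible (2 : F)]
    {V : Type v} [AddCommGroup V] [Module F V] [FiniteDimensional F V] [Nontrivial V]
    (q : QuadraticForm F V) (hq : q.Anisotropic) :
    [ QuadraticForm.IsPfister q,
      ∀ (K : Type (max u w)) [Field K] [Algebra F K],
        QuadraticForm.IsRound (QuadraticForm.baseChange K q),
      ∀ (K : Type (max u w)) [Field K] [Algebra F K],
        QuadraticForm.IsGroupForm (QuadraticForm.baseChange K q) ].TFAE := by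
  tfae_have 1 → 2 := by
    rintro ⟨l, hl⟩ K _ _
    obtain ⟨ι, _, w, hw⟩ := QuadraticForm.exists_isPfisterWeights l
    have hK := (QuadraticForm.equivalent_baseChange K
      (hl.trans hw.equivalent_pfisterForm)).trans
      (QuadraticForm.equivalent_baseChange_weightedSumSquares K w)
    obtain ⟨x, hx⟩ := hw.exists_eq_one K
    obtain ⟨y, hy⟩ := QuadraticForm.exists_eq_of_equivalent hK.symm x
    exact ((hw.hasSimilarValues K).of_equivalent hK.symm).isRound ⟨y, hy.trans hx⟩
  tfae_have 2 → 3 := fun h K _ _ => (h K).1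
  tfae_have 3 → 1 := by
    intro h
    obtain ⟨w, hw⟩ := QuadraticForm.equivalent_weightedSumSquares q
    have hgroup : ∀ (K : Type (max u w)) [Field K] [Algebra F K],
        QuadraticForm.IsGroupForm (weightedSumSquares K w) := by
      intro K _ _
      obtain ⟨H, hH⟩ := h K
      exact ⟨H, hH.trans (QuadraticForm.valueSet_eq_of_equivalent
        ((QuadraticForm.equivalent_baseChange K hw).trans
          (QuadraticForm.equivalent_baseChange_weightedSumSquares K w)))⟩
    -- The hypothesis concerns fields in `Type (max u w)`, the subform argument fields in `Type u`;
    -- `ULift` transports values between them.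
    have hdown : ∀ (K : Type u) [Field K] [Algebra F K] (z : Fin (finrank F V) → ULift.{w} K),
        weightedSumSquares K w (fun i => (z i).down) = (weightedSumSquares (ULift.{w} K) w z).down :=
      fun K _ _ z => QuadraticForm.weightedSumSquares_map w (ULift.algEquiv (R := F)).toAlgHom z
    obtain ⟨l, hl⟩ := QuadraticForm.isPfister_of_values_mul
      (QuadraticForm.anisotropic_of_equivalent hw hq)
      (by
        obtain ⟨x, hx⟩ := (hgroup (ULift.{w} F)).exists_eq_one
        exact ⟨_, by rw [hdown F x, hx]; rfl⟩)
      (fun K _ _ x y => by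
        obtain ⟨z, hz⟩ := (hgroup (ULift.{w} K)).exists_eq_mul
          (fun i => ULift.up (x i)) (fun i => ULift.up (y i))
        refine ⟨_, (hdown K z).trans ?_⟩
        rw [hz, ULift.mul_down, ← hdown, ← hdown])
    exact ⟨l, hw.trans hl⟩
  tfae_finish
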